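/- For every $\varepsilon>0$ there is $k_0=k_0(\varepsilon)$ such that the following holds for all integers $k\ge k_0$ and all integers $\Delta\ge 0$ with $\Delta\le(1-\varepsilon)k\ln k$. Let $G$ be a finite triangle-free simple graph of maximum degree at most $\Delta$. Then $G$ has a proper $k$-colouring, and if $\boldsymbol\sigma$ is a uniformly random proper $k$-colouring of $G$, then for every vertex $v$ of $G$, with probability at least $1-\mathrm{e}^{-\Delta^{\varepsilon/3}}$ (where $0^{\varepsilon/3}=0$), all of the following hold simultaneously: 1. $v$ is $(\Delta+1)$-loose in $\boldsymbol\sigma$: for every colour $j\in[k]$ with $j\ne\boldsymbol\sigma(v)$ there is a proper $k$-colouring $\sigma'$ of $G$ with $\sigma'(v)=j$ that differs from $\boldsymbol\sigma$ on at most $\Delta+1$ vertices; 2. $v$ is thawed in $\boldsymbol\sigma$: for every $j\in[k]$ there is a finite sequence of proper $k$-colourings of $G$, starting at $\boldsymbol\sigma$ and ending at a colouring that gives $v$ the colour $j$, in which any two consecutive colourings differ on at most one vertex; 3. moreover, for every $j\in[k]$ there is a sequence as in 2 in which only $v$ and its neighbours ever change colour. -/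

import Mathlib

namespace ColouringGeometry

variable {V : Type*} [Fintype V]

/-- The distance-`t` `k`-colouring graph: its vertices are the proper `k`-colourings of `G`, and two
distinct proper colourings are adjacent if they differ on at most `t` vertices of `G`. -/
def colouringGraph (G : SimpleGraph V) (k t : ℕ) : SimpleGraph (G.Coloring (Fin k)) where
  Adj τ σ := τ ≠ σ ∧ hammingDist (fun v => τ v) (fun v => σ v) ≤ t
  symm := ⟨fun τ σ h => ⟨h.1.symm, by rw [hammingDist_comm]; exact h.2⟩⟩
  loopless := ⟨fun _ h => h.1 rfl⟩

/-- `v` is `t`-loose in `τ`: for every colour `j` other than the one `v` already has, some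
neighbour of `τ` in the distance-`t` colouring graph gives `v` the colour `j`. (For `j = τ v` the
colouring `τ` itself serves, at distance `0`.) -/
def IsLoose (G : SimpleGraph V) (k t : ℕ) (τ : G.Coloring (Fin k)) (v : V) : Prop :=
  ∀ j : Fin k, j ≠ τ v → ∃ σ : G.Coloring (Fin k), (colouringGraph G k t).Adj τ σ ∧ σ v = j

/-- `v` is `t`-thawed in `τ`: every colour is taken by `v` in some colouring of the `t`-cluster
(connected component of the distance-`t` colouring graph) of `τ`. -/
def IsThawed (G : SimpleGraph V) (k t : ℕ) (τ : G.Coloring (Fin k)) (v : V) : Prop :=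
  ∀ j : Fin k, ∃ σ : G.Coloring (Fin k),
    (colouringGraph G k t).connectedComponentMk σ
      = (colouringGraph G k t).connectedComponentMk τ ∧ σ v = j

/-- `v` can be given any colour by recolouring, one vertex at a time and through proper colourings,
only `v` and its neighbours: along some walk of single-vertex recolourings, no vertex outside the
closed neighbourhood of `v` ever changes colour. -/
def IsLocallyRecolourable (G : SimpleGraph V) (k : ℕ) (τ : G.Coloring (Fin k)) (v : V) : Prop :=
  ∀ j : Fin k, ∃ (σ : G.Coloring (Fin k)) (w : (colouringGraph G k 1).Walk τ σ), σ v = j ∧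
    ∀ ρ ∈ w.support, ∀ u : V, u ≠ v → ¬ G.Adj v u → ρ u = τ u

open scoped Classical in
/-- The law of the uniformly random proper `k`-colouring of `G`. -/
noncomputable def uniformColouring (G : SimpleGraph V) (k : ℕ) [Nonempty (G.Coloring (Fin k))] :
    PMF (G.Coloring (Fin k)) :=
  haveI : Finite (G.Coloring (Fin k)) := DFunLike.finite _
  haveI : Fintype (G.Coloring (Fin k)) := Fintype.ofFinite _
  PMF.uniformOfFintype (G.Coloring (Fin k))

/-- The probability that the uniformly random proper `k`-colouring of `G` lies in `E`. -/
noncomputable def colouringProb (G : SimpleGraph V) (k : ℕ) [Nonempty (G.Coloring (Fin k))]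
    (E : Set (G.Coloring (Fin k))) : ℝ :=
  ((uniformColouring G k).toOuterMeasure E).toReal

end ColouringGeometry

/-! Call a colour available at `v` if no neighbour of `v` has it. If every neighbour of `v` has two
available colours, then the neighbours coloured `j` can leave `j` one after another, without
disturbing each other because triangle-freeness makes them pairwise non-adjacent, and then `v` can
take `j`. So it is enough that a vertex rarely has only one available colour; a union bound over at
most `Δ` neighbours finishes.

Fix a random proper colouring outside the neighbourhood `A` of `v`. As `A` is independent, its
vertices are coloured independently and uniformly from their lists of available colours. If few
lists have size at most `t`, at least `n` colours lie in no such short list, and as in the coupon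
collector problem the expected number of them missed by `A` is at least `n * exp (-Δ(1 + 1/t)/n)`,
which is at least `k^(ε/2)/2` for suitable `t` and `n`. Negative correlation of the missed colours
(`pow_mul_sum_prod_missed_le`) then makes the mean of `2^(-#avail)` tiny
(`sum_half_pow_card_avail_le`).

That many lists are short is unlikely once vertices are known to have at least `l` available colours
on average: the vertices of an independent set all have short lists with probability at most `(t/l)`
to the power of its size (`pow_mul_card_short_le`). This knowledge comes by induction on the vertex
set (`isExpanding_of_cliqueFree`): if it holds inside a set, the mean of `2^(-#avail)` for one
further vertex is small, so that vertex again has at least `l` available colours on average. The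
same induction gives existence of a colouring.

Probabilities appear as counts of maps on all of `V` whose values outside the set in question are
arbitrary; conditioning becomes resampling of coordinates. -/

namespace ColouringGeometry

open Finset

/-! ### Resampling coordinates, and negative correlation of missed colours -/

section Resampling

variable {V C : Type*} [DecidableEq V]

lemma prod_update_of_notMem {A : Finset V} {u : V} (hu : u ∉ A) (w : V → C → ℝ) (g : V → C)
    (x : C) : ∏ a ∈ A, w a (Function.update g u x a) = ∏ a ∈ A, w a (g a) := by
  refine prod_congr rfl fun a ha => ?_
  rw [Function.update_of_ne (ne_of_mem_of_not_mem ha hu)]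

variable [Fintype V] [Fintype C]

/-- Resampling one coordinate of a function preserves sums. -/
lemma card_mul_sum_eq_sum_update (F : (V → C) → ℝ) (u : V) :
    (Fintype.card C : ℝ) * ∑ f, F f = ∑ f : V → C, ∑ x, F (Function.update f u x) := by
  -- Exchanging the old and the new value is a bijection on pairs.
  have hinv : Function.Involutive
      (fun p : (V → C) × C => (Function.update p.1 u p.2, p.1 u)) := by
    rintro ⟨f, x⟩
    simp
  have h := Fintype.sum_equiv hinv.toPerm
    (fun p : (V → C) × C => F (Function.update p.1 u p.2)) (fun p => F p.1) (fun _ => rfl)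
  rw [Fintype.sum_prod_type, Fintype.sum_prod_type] at h
  rw [h, mul_sum]
  simp

/-- Resampling a set of coordinates of a function preserves sums. -/
lemma card_mul_sum_eq_sum_piecewise (F : (V → C) → ℝ) (A : Finset V) :
    (Fintype.card (V → C) : ℝ) * ∑ f, F f = ∑ f : V → C, ∑ g : V → C, F (A.piecewise g f) := by
  have hinv : Function.Involutive
      (fun p : (V → C) × (V → C) => (A.piecewise p.2 p.1, A.piecewise p.1 p.2)) := by
    rintro ⟨f, g⟩
    ext v <;> by_cases hv : v ∈ A <;> simp [hv]
  have h := Fintype.sum_equiv hinv.toPerm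
    (fun p : (V → C) × (V → C) => F (A.piecewise p.2 p.1)) (fun p => F p.1) (fun _ => rfl)
  rw [Fintype.sum_prod_type, Fintype.sum_prod_type] at h
  rw [h, mul_sum]
  simp

/-- Independence in counting form: each choice on `A` occurs once for every choice outside `A`,
which accounts for the two normalising factors. -/
lemma pow_mul_sum_prod (A : Finset V) (w : V → C → ℝ) :
    (Fintype.card C : ℝ) ^ #A * ∑ g : V → C, ∏ u ∈ A, w u (g u) =
      (Fintype.card (V → C) : ℝ) * ∏ u ∈ A, ∑ c, w u c := by
  induction A using Finset.induction_on with
  | empty => simp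
  | insert u A hu ih =>
    rw [card_insert_of_notMem hu, pow_succ, mul_assoc, card_mul_sum_eq_sum_update _ u,
      prod_insert hu, mul_left_comm, ← ih, mul_left_comm]
    congr 1
    rw [mul_sum]
    refine sum_congr rfl fun g _ => ?_
    rw [sum_mul]
    refine sum_congr rfl fun x _ => ?_
    rw [prod_insert hu, prod_update_of_notMem hu, Function.update_self]

lemma one_add_sum_le_prod_one_add {ι : Type*} (s : Finset ι) (y : ι → ℝ) (hy : ∀ i ∈ s, 0 ≤ y i) :
    1 + ∑ i ∈ s, y i ≤ ∏ i ∈ s, (1 + y i) := by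
  classical
  induction s using Finset.induction_on with
  | empty => simp
  | insert i s hi ih =>
    have h1 := ih fun j hj => hy j (mem_insert_of_mem hj)
    have h2 : 0 ≤ ∑ j ∈ s, y j := sum_nonneg fun j hj => hy j (mem_insert_of_mem hj)
    have h3 := hy i (mem_insert_self i s)
    rw [sum_insert hi, prod_insert hi]
    nlinarith [mul_nonneg h3 h2]

variable [DecidableEq C]

/-- One step of the negative correlation argument for colours missed by random choices. -/
lemma sum_mul_prod_erase_le (p b : C → ℝ) (hp0 : ∀ c, 0 ≤ p c) (hp1 : ∑ c, p c = 1)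
    (hb0 : ∀ c, 0 ≤ b c) (hb1 : ∀ c, b c < 1) :
    ∑ x, p x * ∏ c, (1 - (if x = c then 0 else b c)) ≤ ∏ c, (1 - b c * (1 - p c)) := by
  -- Dividing by `∏ c, (1 - b c)` reduces the claim to `1 + ∑ y c ≤ ∏ (1 + y c)` with `y c = p c * b
  -- c / (1 - b c)`.
  have hpos : ∀ c, 0 < 1 - b c := fun c => sub_pos.2 (hb1 c)
  have hx : ∀ x, ∏ c, (1 - (if x = c then 0 else b c)) = (∏ c, (1 - b c)) * (1 - b x)⁻¹ := by
    intro x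
    rw [← mul_prod_erase univ _ (mem_univ x), ← mul_prod_erase univ (fun c => 1 - b c)
      (mem_univ x)]
    have : ∏ c ∈ univ.erase x, (1 - (if x = c then 0 else b c)) =
        ∏ c ∈ univ.erase x, (1 - b c) :=
      prod_congr rfl fun c hc => by rw [if_neg (ne_of_mem_erase hc).symm]
    rw [this]
    have := (hpos x).ne'
    simp
    field_simp
  have hc : ∀ c, 1 - b c * (1 - p c) = (1 - b c) * (1 + p c * b c * (1 - b c)⁻¹) := by
    intro c
    have := (hpos c).ne'
    field_simp
    ring
  simp_rw [hx, hc]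
  rw [prod_mul_distrib]
  have h1 : ∑ x, p x * ((∏ c, (1 - b c)) * (1 - b x)⁻¹) =
      (∏ c, (1 - b c)) * (1 + ∑ c, p c * b c * (1 - b c)⁻¹) := by
    generalize ∏ c, (1 - b c) = P
    nth_rewrite 2 [← hp1]
    rw [← sum_add_distrib, mul_sum]
    refine sum_congr rfl fun x _ => ?_
    have := (hpos x).ne'
    field_simp
    ring
  rw [h1]
  refine mul_le_mul_of_nonneg_left ?_ (prod_nonneg fun c _ => (hpos c).le)
  exact one_add_sum_le_prod_one_add univ _ fun c _ =>
    mul_nonneg (mul_nonneg (hp0 c) (hb0 c)) (inv_nonneg.2 (hpos c).le)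

/-- Negative correlation of the colours missed by independent random choices. -/
lemma pow_mul_sum_prod_missed_le (A : Finset V) (w : V → C → ℝ) (hw0 : ∀ u c, 0 ≤ w u c)
    (hw1 : ∀ u ∈ A, ∑ c, w u c = 1) (a : C → ℝ) (ha0 : ∀ c, 0 ≤ a c) (ha1 : ∀ c, a c < 1) :
    (Fintype.card C : ℝ) ^ #A * ∑ g : V → C, (∏ u ∈ A, w u (g u)) *
        ∏ c, (1 - if ∀ u ∈ A, g u ≠ c then a c else 0) ≤
      (Fintype.card (V → C) : ℝ) * ∏ c, (1 - a c * ∏ u ∈ A, (1 - w u c)) := by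
  induction A using Finset.induction_on generalizing a with
  | empty => simp
  | insert u A hu ih =>
    have hw1' : ∀ v ∈ A, ∑ c, w v c = 1 := fun v hv => hw1 v (mem_insert_of_mem hv)
    have hwle : ∀ v ∈ A, ∀ c, w v c ≤ 1 := fun v hv c => by
      rw [← hw1' v hv]
      exact single_le_sum (fun c _ => hw0 v c) (mem_univ c)
    have hq0 : ∀ c, 0 ≤ ∏ v ∈ A, (1 - w v c) := fun c =>
      prod_nonneg fun v hv => sub_nonneg.2 (hwle v hv c)
    have hq1 : ∀ c, ∏ v ∈ A, (1 - w v c) ≤ 1 := fun c =>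
      prod_le_one (fun v hv => sub_nonneg.2 (hwle v hv c)) fun v _ => by linarith [hw0 v c]
    -- Once `u` picks `x`, the colour `x` is no longer missed. This amounts to setting `a x` to `0`,
    -- which is why the induction generalises `a`.
    have key : ∀ g : V → C, ∀ x, (∏ v ∈ insert u A, w v (Function.update g u x v)) *
        ∏ c, (1 - if ∀ v ∈ insert u A, Function.update g u x v ≠ c then a c else 0) =
        w u x * ((∏ v ∈ A, w v (g v)) *
          ∏ c, (1 - if ∀ v ∈ A, g v ≠ c then (if x = c then 0 else a c) else 0)) := by
      intro g x
      rw [prod_insert hu, prod_update_of_notMem hu, Function.update_self, mul_assoc]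
      congr 2
      refine prod_congr rfl fun c _ => ?_
      have : (∀ v ∈ insert u A, Function.update g u x v ≠ c) ↔ x ≠ c ∧ ∀ v ∈ A, g v ≠ c := by
        rw [forall_mem_insert, Function.update_self]
        refine and_congr_right fun _ => forall₂_congr fun v hv => ?_
        rw [Function.update_of_ne (ne_of_mem_of_not_mem hv hu)]
      simp only [this]
      by_cases h1 : x = c <;> by_cases h2 : ∀ v ∈ A, g v ≠ c <;> simp [h1, h2]
    rw [card_insert_of_notMem hu, pow_succ, mul_assoc, card_mul_sum_eq_sum_update _ u]
    simp_rw [key]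
    rw [sum_comm]
    simp_rw [← mul_sum]
    rw [mul_sum]
    calc ∑ x, (Fintype.card C : ℝ) ^ #A * (w u x * ∑ g : V → C, (∏ v ∈ A, w v (g v)) *
          ∏ c, (1 - if ∀ v ∈ A, g v ≠ c then (if x = c then 0 else a c) else 0))
        ≤ ∑ x, w u x * ((Fintype.card (V → C) : ℝ) *
          ∏ c, (1 - (if x = c then 0 else a c) * ∏ v ∈ A, (1 - w v c))) := by
          refine sum_le_sum fun x _ => ?_
          rw [mul_left_comm]
          refine mul_le_mul_of_nonneg_left (ih hw1' _ ?_ ?_) (hw0 u x)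
          · intro c; split_ifs <;> simp [ha0]
          · intro c; split_ifs <;> simp [ha1]
      _ = (Fintype.card (V → C) : ℝ) * ∑ x, w u x *
          ∏ c, (1 - (if x = c then 0 else a c * ∏ v ∈ A, (1 - w v c))) := by
          rw [mul_sum]
          refine sum_congr rfl fun x _ => ?_
          rw [mul_left_comm]
          simp only [ite_mul, zero_mul]
      _ ≤ _ := by
          refine mul_le_mul_of_nonneg_left ?_ (Nat.cast_nonneg _)
          refine (sum_mul_prod_erase_le (w u) _ (hw0 u) (hw1 u (mem_insert_self u A))
            (fun c => mul_nonneg (ha0 c) (hq0 c)) fun c => ?_).trans_eq ?_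
          · exact (mul_le_of_le_one_right (ha0 c) (hq1 c)).trans_lt (ha1 c)
          · refine prod_congr rfl fun c _ => ?_
            rw [prod_insert hu]
            ring

end Resampling

/-! ### Coupon collecting with lists of colours -/

section Lists

variable {V C : Type*} [DecidableEq C]

lemma exp_neg_inv_le_one_sub_inv {n : ℝ} (hn : 1 < n) : Real.exp (-(n - 1)⁻¹) ≤ 1 - n⁻¹ := by
  have h0 : 0 < n - 1 := by linarith
  have h : n / (n - 1) ≤ Real.exp ((n - 1)⁻¹) := by
    refine le_trans (le_of_eq ?_) (Real.add_one_le_exp _)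
    field_simp
    ring
  rw [Real.exp_neg]
  refine (inv_anti₀ (by positivity) h).trans_eq ?_
  field_simp

/-- The uniform distribution on a finite set of colours. -/
noncomputable def uniformWeight (L : Finset C) (c : C) : ℝ := if c ∈ L then (#L : ℝ)⁻¹ else 0

lemma uniformWeight_nonneg (L : Finset C) (c : C) : 0 ≤ uniformWeight L c := by
  unfold uniformWeight
  split_ifs <;> positivity

variable [Fintype C]

lemma sum_uniformWeight {L : Finset C} (hL : L.Nonempty) : ∑ c, uniformWeight L c = 1 := by
  have : (#L : ℝ) ≠ 0 := by exact_mod_cast hL.card_pos.ne'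
  simp [uniformWeight, this]

/-- The colours that lie in no list of size at most `t`. -/
def freeColours (A : Finset V) (L : V → Finset C) (t : ℕ) : Finset C :=
  univ.filter fun c => ∀ u ∈ A, #(L u) ≤ t → c ∉ L u

lemma le_card_freeColours (A : Finset V) (L : V → Finset C) (t : ℕ) :
    (Fintype.card C : ℝ) - t * #(A.filter fun u => #(L u) ≤ t) ≤ #(freeColours A L t) := by
  have h1 : #((A.filter fun u => #(L u) ≤ t).biUnion L) ≤ #(A.filter fun u => #(L u) ≤ t) * t :=
    card_biUnion_le_card_mul _ _ _ fun u hu => (mem_filter.1 hu).2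
  have h2 : (univ : Finset C) ⊆
      freeColours A L t ∪ (A.filter fun u => #(L u) ≤ t).biUnion L := by
    intro c _
    simp only [mem_union, freeColours, mem_filter, mem_univ, true_and, mem_biUnion]
    by_contra! h
    obtain ⟨⟨u, hu, hut, hc⟩, h'⟩ := h
    exact h' u ⟨hu, hut⟩ hc
  have h3 := (card_le_card h2).trans (card_union_le _ _)
  rw [card_univ] at h3
  have h4 : (Fintype.card C : ℝ) ≤
      #(freeColours A L t) + #(A.filter fun u => #(L u) ≤ t) * t := by
    exact_mod_cast h3.trans (Nat.add_le_add_left h1 _)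
  linarith

/-- The expected number of free colours missed by independent uniform choices from lists. -/
lemma le_sum_prod_one_sub_uniformWeight (A : Finset V) (L : V → Finset C) {t : ℕ} (ht : 1 ≤ t)
    {n d : ℝ} (hn : 0 < n)
    (hbad : t * (#(A.filter fun u => #(L u) ≤ t) : ℝ) ≤ Fintype.card C - n) (hA : (#A : ℝ) ≤ d) :
    n * Real.exp (-(d * (1 + (t : ℝ)⁻¹) / n)) ≤
      ∑ c ∈ freeColours A L t, ∏ u ∈ A, (1 - uniformWeight (L u) c) := by
  have htpos : (0 : ℝ) < t := by exact_mod_cast ht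
  have hN : n ≤ #(freeColours A L t) := by linarith [le_card_freeColours A L t]
  set F := freeColours A L t with hF
  -- A free colour lies only in lists of size `m > t`, where `1 - 1/m ≥ exp (-1/(m - 1))`; one list
  -- contributes at most `m/(m - 1) ≤ 1 + 1/t` to the sum of the exponents.
  let z : V → C → ℝ := fun u c => if t < #(L u) ∧ c ∈ L u then ((#(L u) : ℝ) - 1)⁻¹ else 0
  have hz : ∀ c ∈ F, ∀ u ∈ A, Real.exp (-z u c) ≤ 1 - uniformWeight (L u) c := by
    intro c hc u hu
    rw [hF, freeColours, mem_filter] at hc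
    simp only [z, uniformWeight]
    by_cases hcu : c ∈ L u
    · have hlt : t < #(L u) := by
        by_contra h
        exact hc.2 u hu (not_lt.1 h) hcu
      rw [if_pos ⟨hlt, hcu⟩, if_pos hcu]
      exact exp_neg_inv_le_one_sub_inv (by exact_mod_cast (by omega : 1 < #(L u)))
    · simp [hcu]
  have hzsum : ∀ u, ∑ c, z u c ≤ 1 + (t : ℝ)⁻¹ := by
    intro u
    by_cases hlt : t < #(L u)
    · have h1 : (t : ℝ) ≤ #(L u) - 1 := by
        have : ((t + 1 : ℕ) : ℝ) ≤ #(L u) := by exact_mod_cast hlt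
        push_cast at this
        linarith
      have h2 : (0 : ℝ) < #(L u) - 1 := by linarith
      have h3 : ∑ c, z u c = #(L u) * ((#(L u) : ℝ) - 1)⁻¹ := by
        simp [z, hlt]
      rw [h3]
      have h4 : (#(L u) : ℝ) * ((#(L u) : ℝ) - 1)⁻¹ = 1 + ((#(L u) : ℝ) - 1)⁻¹ := by
        field_simp
        ring
      rw [h4]
      gcongr
    · have : ∑ c, z u c = 0 := by simp [z, hlt]
      rw [this]
      positivity
  have hz0 : ∀ u c, 0 ≤ z u c := by
    intro u c
    simp only [z]
    split_ifs with h
    · have : (1 : ℝ) ≤ #(L u) := by exact_mod_cast (by omega : 1 ≤ #(L u))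
      exact inv_nonneg.2 (by linarith)
    · exact le_rfl
  have hX : ∑ c ∈ F, ∑ u ∈ A, z u c ≤ d * (1 + (t : ℝ)⁻¹) := by
    calc ∑ c ∈ F, ∑ u ∈ A, z u c ≤ ∑ c, ∑ u ∈ A, z u c :=
          sum_le_sum_of_subset_of_nonneg (subset_univ _) fun c _ _ =>
            sum_nonneg fun u _ => hz0 u c
      _ = ∑ u ∈ A, ∑ c, z u c := sum_comm
      _ ≤ ∑ u ∈ A, (1 + (t : ℝ)⁻¹) := sum_le_sum fun u _ => hzsum u
      _ = #A * (1 + (t : ℝ)⁻¹) := by rw [sum_const, nsmul_eq_mul]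
      _ ≤ _ := by gcongr
  set y := d * (1 + (t : ℝ)⁻¹) / n with hy
  have hyn : n * y = d * (1 + (t : ℝ)⁻¹) := by rw [hy]; field_simp
  have hy0 : 0 ≤ y := by
    have : 0 ≤ d := (Nat.cast_nonneg _).trans hA
    positivity
  -- Jensen's inequality by the tangent to `exp (-x)` at `y`, the bound on the total exponent
  -- divided by `n`. The tangent form needs only `n ≤ #F`, not equality.
  have htan : ∀ x : ℝ, Real.exp (-y) * (1 + y - x) ≤ Real.exp (-x) := by
    intro x
    have h := Real.add_one_le_exp (y - x)
    have h2 : Real.exp (-x) = Real.exp (-y) * Real.exp (y - x) := by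
      rw [← Real.exp_add]; congr 1; ring
    rw [h2]
    refine mul_le_mul_of_nonneg_left (by linarith) (Real.exp_nonneg _)
  calc n * Real.exp (-y)
      ≤ Real.exp (-y) * (#F * (1 + y) - ∑ c ∈ F, ∑ u ∈ A, z u c) := by
        rw [mul_comm]
        refine mul_le_mul_of_nonneg_left ?_ (Real.exp_nonneg _)
        nlinarith [mul_le_mul_of_nonneg_right hN hy0]
    _ = ∑ c ∈ F, Real.exp (-y) * (1 + y - ∑ u ∈ A, z u c) := by
        rw [← mul_sum, sum_sub_distrib, sum_const, nsmul_eq_mul]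
    _ ≤ ∑ c ∈ F, ∏ u ∈ A, (1 - uniformWeight (L u) c) := by
        refine sum_le_sum fun c hc => (htan _).trans ?_
        rw [← sum_neg_distrib, Real.exp_sum]
        exact prod_le_prod (fun u _ => Real.exp_nonneg _) (hz c hc)

variable [Fintype V] [DecidableEq V]

/-- The colours missed by `g` on `A`. -/
def missedColours (A : Finset V) (g : V → C) : Finset C := univ.filter fun c => ∀ u ∈ A, g u ≠ c

/-- If few lists are short, then independent uniform choices from the lists are unlikely to
miss few colours. -/
lemma sum_half_pow_missedColours_le (A : Finset V) (L : V → Finset C) {t : ℕ} (ht : 1 ≤ t)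
    {n d : ℝ} (hn : 0 < n)
    (hbad : t * (#(A.filter fun u => #(L u) ≤ t) : ℝ) ≤ Fintype.card C - n) (hA : (#A : ℝ) ≤ d) :
    ∑ g : V → C, (if ∀ u ∈ A, g u ∈ L u then (1 / 2 : ℝ) ^ #(missedColours A g) else 0) ≤
      Real.exp (-(n * Real.exp (-(d * (1 + (t : ℝ)⁻¹) / n)) / 2)) *
        ∑ g : V → C, (if ∀ u ∈ A, g u ∈ L u then (1 : ℝ) else 0) := by
  by_cases hne : ∀ u ∈ A, (L u).Nonempty
  swap
  · push Not at hne
    obtain ⟨u, hu, hLu⟩ := hne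
    have h : ∀ g : V → C, ¬ ∀ u ∈ A, g u ∈ L u := fun g hg => by
      have := hg u hu
      rw [hLu] at this
      simp at this
    simp [h]
  set P : ℝ := ∏ u ∈ A, (#(L u) : ℝ) with hP
  have hP0 : 0 < P := prod_pos fun u hu => by exact_mod_cast (hne u hu).card_pos
  have hind : ∀ g : V → C, (if ∀ u ∈ A, g u ∈ L u then (1 : ℝ) else 0) =
      P * ∏ u ∈ A, uniformWeight (L u) (g u) := by
    intro g
    rw [hP, ← prod_mul_distrib]
    split_ifs with h
    · symm
      refine prod_eq_one fun u hu => ?_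
      have : (#(L u) : ℝ) ≠ 0 := by exact_mod_cast (hne u hu).card_pos.ne'
      simp [uniformWeight, h u hu, this]
    · push Not at h
      obtain ⟨u, hu, hgu⟩ := h
      symm
      exact prod_eq_zero hu (by simp [uniformWeight, hgu])
  -- The factor `1/2` is kept for free colours only; dropping it for the others merely increases the
  -- product.
  let a : C → ℝ := fun c => if c ∈ freeColours A L t then 1 / 2 else 0
  have ha0 : ∀ c, 0 ≤ a c := fun c => by simp only [a]; split_ifs <;> norm_num
  have ha1 : ∀ c, a c < 1 := fun c => by simp only [a]; split_ifs <;> norm_num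
  have hhalf : ∀ g : V → C, (1 / 2 : ℝ) ^ #(missedColours A g) ≤
      ∏ c, (1 - if ∀ u ∈ A, g u ≠ c then a c else 0) := by
    intro g
    rw [← prod_const, missedColours, prod_filter]
    refine prod_le_prod (fun c _ => by split_ifs <;> norm_num) fun c _ => ?_
    simp only [a]
    split_ifs <;> norm_num
  have hcoupon := pow_mul_sum_prod_missed_le A (fun u => uniformWeight (L u))
    (fun u => uniformWeight_nonneg _) (fun u hu => sum_uniformWeight (hne u hu)) a ha0 ha1
  have htotal := pow_mul_sum_prod A (fun u => uniformWeight (L u))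
  rw [prod_congr rfl fun u hu => sum_uniformWeight (hne u hu), prod_const_one, mul_one] at htotal
  have hexp : ∏ c, (1 - a c * ∏ u ∈ A, (1 - uniformWeight (L u) c)) ≤
      Real.exp (-(n * Real.exp (-(d * (1 + (t : ℝ)⁻¹) / n)) / 2)) := by
    have hw1 : ∀ u ∈ A, ∀ c, uniformWeight (L u) c ≤ 1 := fun u hu c => by
      rw [← sum_uniformWeight (hne u hu)]
      exact single_le_sum (fun c _ => uniformWeight_nonneg _ c) (mem_univ c)
    have hq0 : ∀ c, 0 ≤ ∏ u ∈ A, (1 - uniformWeight (L u) c) := fun c =>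
      prod_nonneg fun u hu => sub_nonneg.2 (hw1 u hu c)
    have hq1 : ∀ c, ∏ u ∈ A, (1 - uniformWeight (L u) c) ≤ 1 := fun c =>
      prod_le_one (fun u hu => sub_nonneg.2 (hw1 u hu c)) fun u _ => by
        linarith [uniformWeight_nonneg (L u) c]
    calc ∏ c, (1 - a c * ∏ u ∈ A, (1 - uniformWeight (L u) c))
        ≤ ∏ c, Real.exp (-(a c * ∏ u ∈ A, (1 - uniformWeight (L u) c))) := by
          refine prod_le_prod (fun c _ => ?_) fun c _ => Real.one_sub_le_exp_neg _
          nlinarith [ha0 c, ha1 c, hq0 c, hq1 c]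
      _ = Real.exp (-((∑ c ∈ freeColours A L t, ∏ u ∈ A, (1 - uniformWeight (L u) c)) / 2)) := by
          rw [← Real.exp_sum, sum_neg_distrib, sum_div]
          simp only [a, ite_mul, zero_mul, sum_ite_mem, univ_inter]
          congr 2
          exact sum_congr rfl fun c _ => by ring
      _ ≤ _ := by
          rw [Real.exp_le_exp]
          linarith [le_sum_prod_one_sub_uniformWeight A L ht hn hbad hA]
  set η := Real.exp (-(n * Real.exp (-(d * (1 + (t : ℝ)⁻¹) / n)) / 2))
  rcases isEmpty_or_nonempty C with hC | hC
  · have : (0 : ℝ) ≤ Fintype.card C - n := le_trans (by positivity) hbad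
    simp at this
    linarith
  have hk : (0 : ℝ) < (Fintype.card C : ℝ) ^ #A := by
    have : 0 < Fintype.card C := Fintype.card_pos
    positivity
  have hmain : ∑ g : V → C, (∏ u ∈ A, uniformWeight (L u) (g u)) *
      (1 / 2 : ℝ) ^ #(missedColours A g) ≤
      η * ∑ g : V → C, ∏ u ∈ A, uniformWeight (L u) (g u) := by
    refine le_of_mul_le_mul_left ?_ hk
    calc _ ≤ (Fintype.card C : ℝ) ^ #A * ∑ g : V → C, (∏ u ∈ A, uniformWeight (L u) (g u)) *
          ∏ c, (1 - if ∀ u ∈ A, g u ≠ c then a c else 0) := by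
          refine mul_le_mul_of_nonneg_left (sum_le_sum fun g _ => ?_) hk.le
          exact mul_le_mul_of_nonneg_left (hhalf g)
            (prod_nonneg fun u _ => uniformWeight_nonneg _ _)
      _ ≤ (Fintype.card (V → C) : ℝ) * η :=
          hcoupon.trans (mul_le_mul_of_nonneg_left hexp (Nat.cast_nonneg _))
      _ = _ := by rw [← htotal]; ring
  calc _ = P * ∑ g : V → C, (∏ u ∈ A, uniformWeight (L u) (g u)) *
        (1 / 2 : ℝ) ^ #(missedColours A g) := by
        rw [mul_sum]
        refine sum_congr rfl fun g _ => ?_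
        rw [← mul_assoc, ← hind]
        split_ifs <;> simp
    _ ≤ P * (η * ∑ g : V → C, ∏ u ∈ A, uniformWeight (L u) (g u)) :=
        mul_le_mul_of_nonneg_left hmain hP0.le
    _ = _ := by
        simp_rw [hind]
        rw [← mul_sum]
        ring

end Lists

/-! ### Available colours in random proper colourings -/

section Counting

variable {V : Type*} [Fintype V] [DecidableEq V] (G : SimpleGraph V) [DecidableRel G.Adj] {k : ℕ}

/-- The maps that are proper colourings when restricted to `S`; they are arbitrary outside `S`. -/
def properOn (k : ℕ) (S : Finset V) : Finset (V → Fin k) :=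
  univ.filter fun f => ∀ u ∈ S, ∀ w ∈ S, G.Adj u w → f u ≠ f w

/-- The colours not used by `f` on the neighbours of `v` in `S`. -/
def avail (S : Finset V) (v : V) (f : V → Fin k) : Finset (Fin k) :=
  missedColours (S.filter (G.Adj v)) f

variable {G}

lemma mem_properOn {S : Finset V} {f : V → Fin k} :
    f ∈ properOn G k S ↔ ∀ u ∈ S, ∀ w ∈ S, G.Adj u w → f u ≠ f w := by
  simp [properOn]

lemma mem_avail {S : Finset V} {v : V} {f : V → Fin k} {c : Fin k} :
    c ∈ avail G S v f ↔ ∀ w ∈ S, G.Adj v w → f w ≠ c := by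
  simp [avail, missedColours]

lemma mem_properOn_congr {S : Finset V} {f g : V → Fin k} (h : ∀ w ∈ S, f w = g w) :
    f ∈ properOn G k S ↔ g ∈ properOn G k S := by
  simp only [mem_properOn]
  refine forall₂_congr fun u hu => forall₂_congr fun w hw => ?_
  rw [h u hu, h w hw]

lemma avail_congr {S T : Finset V} {v : V} {f g : V → Fin k}
    (hST : ∀ w, G.Adj v w → (w ∈ S ↔ w ∈ T)) (h : ∀ w ∈ S, G.Adj v w → f w = g w) :
    avail G S v f = avail G T v g := by
  ext c
  simp only [mem_avail]
  constructor
  · intro hc w hw hvw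
    rw [← h w ((hST w hvw).2 hw) hvw]
    exact hc w ((hST w hvw).2 hw) hvw
  · intro hc w hw hvw
    rw [h w hw hvw]
    exact hc w ((hST w hvw).1 hw) hvw

lemma mem_properOn_insert {S : Finset V} {u : V} {f : V → Fin k} :
    f ∈ properOn G k (insert u S) ↔ f ∈ properOn G k S ∧ f u ∈ avail G S u f := by
  simp only [mem_properOn, mem_avail, forall_mem_insert]
  constructor
  · rintro ⟨h1, h2⟩
    exact ⟨fun v hv w hw => (h2 v hv).2 w hw, fun w hw hvw => (h1.2 w hw hvw).symm⟩
  · rintro ⟨h1, h2⟩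
    exact ⟨⟨fun h => absurd rfl h.ne, fun w hw hvw => (h2 w hw hvw).symm⟩,
      fun v hv => ⟨fun hvu => h2 v hv hvu.symm, h1 v hv⟩⟩

/-- Exposing the colour of one vertex last. -/
lemma mul_sum_properOn_insert {S : Finset V} {u : V} (hu : u ∉ S) (h : (V → Fin k) → ℝ)
    (hh : ∀ f x, h (Function.update f u x) = h f) :
    (k : ℝ) * ∑ f ∈ properOn G k (insert u S), h f =
      ∑ f ∈ properOn G k S, (#(avail G S u f) : ℝ) * h f := by
  have h1 : ∑ f ∈ properOn G k (insert u S), h f =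
      ∑ f, if f ∈ properOn G k (insert u S) then h f else 0 := by
    rw [← sum_filter]
    simp
  have h2 : ∑ f ∈ properOn G k S, (#(avail G S u f) : ℝ) * h f =
      ∑ f, if f ∈ properOn G k S then (#(avail G S u f) : ℝ) * h f else 0 := by
    rw [← sum_filter]
    simp
  have h3 := card_mul_sum_eq_sum_update
    (fun f : V → Fin k => if f ∈ properOn G k (insert u S) then h f else 0) u
  rw [Fintype.card_fin] at h3
  rw [h1, h2, h3]
  refine sum_congr rfl fun f _ => ?_
  have hne : ∀ w ∈ S, w ≠ u := fun w hw => ne_of_mem_of_not_mem hw hu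
  -- Of the `k` values that resampling can put at `u`, exactly the available ones keep the map
  -- proper.
  have key : ∀ x, Function.update f u x ∈ properOn G k (insert u S) ↔
      f ∈ properOn G k S ∧ x ∈ avail G S u f := by
    intro x
    rw [mem_properOn_insert, Function.update_self,
      mem_properOn_congr (g := f) fun w hw => Function.update_of_ne (hne w hw) _ _,
      avail_congr (T := S) (g := f) (fun _ _ => Iff.rfl)
        fun w hw _ => Function.update_of_ne (hne w hw) _ _]
  simp_rw [key, hh]
  by_cases hf : f ∈ properOn G k S <;> simp [hf]

lemma mul_card_properOn_insert {S : Finset V} {u : V} (hu : u ∉ S) :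
    (k : ℝ) * #(properOn G k (insert u S)) = ∑ f ∈ properOn G k S, (#(avail G S u f) : ℝ) := by
  simpa using mul_sum_properOn_insert (G := G) (k := k) hu (fun _ => 1) fun _ _ => rfl

variable (G k) in
/-- Inside `S`, a vertex has on average at least `l` available colours when the remaining
vertices are properly coloured at random. -/
def IsExpanding (l : ℝ) (S : Finset V) : Prop :=
  ∀ T u, u ∉ T → insert u T ⊆ S → l * #(properOn G k T) ≤ k * #(properOn G k (insert u T))

lemma IsExpanding.mono {l : ℝ} {S T : Finset V} (h : IsExpanding G k l S) (hTS : T ⊆ S) :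
    IsExpanding G k l T := fun U u hu hUT => h U u hu (hUT.trans hTS)

/-- It is unlikely that all vertices of an independent set have few available colours. -/
lemma pow_mul_card_short_le (hk : 0 < k) {l : ℝ} (hl : 0 ≤ l) (t : ℕ) {S B : Finset V}
    (hS : IsExpanding G k l S) (hBS : B ⊆ S) (hB : ∀ u ∈ B, ∀ w ∈ B, ¬ G.Adj u w) :
    l ^ #B * #((properOn G k S).filter fun f => ∀ u ∈ B, #(avail G S u f) ≤ t) ≤
      (t : ℝ) ^ #B * #(properOn G k S) := by
  induction B using Finset.induction_on generalizing S with
  | empty => simp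
  | insert u B hu ih =>
    obtain ⟨T, huT, rfl⟩ : ∃ T, u ∉ T ∧ insert u T = S :=
      ⟨S.erase u, notMem_erase u S, insert_erase (hBS (mem_insert_self u B))⟩
    have hBT : B ⊆ T := fun w hw =>
      (mem_insert.1 (hBS (mem_insert_of_mem hw))).resolve_left (ne_of_mem_of_not_mem hw hu)
    have ih' := ih (hS.mono (subset_insert u T)) hBT
      fun v hv w hw => hB v (mem_insert_of_mem hv) w (mem_insert_of_mem hw)
    -- By independence of `insert u B`, its vertices do not see `u`: their available colours ignore
    -- both the presence and the colour of `u`.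
    have hup : ∀ w ∈ insert u B, ∀ f x, avail G (insert u T) w (Function.update f u x) =
        avail (k := k) G T w f := by
      intro w hw f x
      have hne : ∀ y, G.Adj w y → y ≠ u := by
        rintro y hy rfl
        exact hB w hw y (mem_insert_self y B) hy
      refine avail_congr (fun y hy => ?_) fun y _ hy => Function.update_of_ne (hne y hy) _ _
      simp [hne y hy]
    have hav : ∀ w ∈ insert u B, ∀ f, avail (k := k) G (insert u T) w f = avail G T w f := by
      intro w hw f
      simpa using hup w hw f (f u)
    have hk' : (0 : ℝ) < k := by exact_mod_cast hk
    -- With `u` exposed last, the event leaves it at most `t` colours, against an average of at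
    -- least `l` without the event. Each vertex of `B` thus costs a factor `t/l`.
    have hstep : (k : ℝ) * #((properOn G k (insert u T)).filter
        fun f => ∀ w ∈ insert u B, #(avail G (insert u T) w f) ≤ t) ≤
        t * #((properOn G k T).filter fun f => ∀ w ∈ B, #(avail G T w f) ≤ t) := by
      have h1 := mul_sum_properOn_insert (G := G) (k := k) huT
        (fun f => if ∀ w ∈ insert u B, #(avail G (insert u T) w f) ≤ t then 1 else 0) (by
          intro f x
          refine if_congr (forall₂_congr fun w hw => ?_) rfl rfl
          rw [hup w hw, hav w hw])
      rw [sum_boole] at h1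
      rw [h1, ← sum_boole, mul_sum]
      refine sum_le_sum fun f _ => ?_
      by_cases hf : ∀ w ∈ insert u B, #(avail G (insert u T) w f) ≤ t
      · have h2 : ∀ w ∈ B, #(avail G T w f) ≤ t := fun w hw => by
          rw [← hav w (mem_insert_of_mem hw)]
          exact hf w (mem_insert_of_mem hw)
        have h3 : #(avail G T u f) ≤ t := by
          rw [← hav u (mem_insert_self u B)]
          exact hf u (mem_insert_self u B)
        rw [if_pos hf, if_pos h2]
        gcongr
      · rw [if_neg hf]
        split_ifs <;> simp
    rw [card_insert_of_notMem hu, pow_succ, pow_succ]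
    refine le_of_mul_le_mul_left ?_ hk'
    calc (k : ℝ) * (l ^ #B * l * #((properOn G k (insert u T)).filter
          fun f => ∀ w ∈ insert u B, #(avail G (insert u T) w f) ≤ t))
        = l ^ #B * l * (k * #((properOn G k (insert u T)).filter
          fun f => ∀ w ∈ insert u B, #(avail G (insert u T) w f) ≤ t)) := by ring
      _ ≤ l ^ #B * l * (t * #((properOn G k T).filter
          fun f => ∀ w ∈ B, #(avail G T w f) ≤ t)) := by gcongr
      _ = l * t * (l ^ #B * #((properOn G k T).filter
          fun f => ∀ w ∈ B, #(avail G T w f) ≤ t)) := by ring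
      _ ≤ l * t * ((t : ℝ) ^ #B * #(properOn G k T)) := by gcongr
      _ = t * (t : ℝ) ^ #B * (l * #(properOn G k T)) := by ring
      _ ≤ t * (t : ℝ) ^ #B * (k * #(properOn G k (insert u T))) :=
          mul_le_mul_of_nonneg_left (hS T u huT subset_rfl) (by positivity)
      _ = _ := by ring

/-- Exponential moment of the number of vertices of an independent set with few available
colours. -/
lemma sum_two_pow_card_short_le (hk : 0 < k) {l : ℝ} (hl : 0 < l) (t : ℕ) {S A : Finset V}
    (hS : IsExpanding G k l S) (hAS : A ⊆ S) (hA : ∀ u ∈ A, ∀ w ∈ A, ¬ G.Adj u w) :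
    ∑ f ∈ properOn G k S, (2 : ℝ) ^ #(A.filter fun u => #(avail G S u f) ≤ t) ≤
      (1 + t / l) ^ #A * #(properOn G k S) := by
  -- The power of two counts the sets `B` consisting of short vertices only.
  have h1 : ∀ f : V → Fin k, (2 : ℝ) ^ #(A.filter fun u => #(avail G S u f) ≤ t) =
      ∑ B ∈ A.powerset, if ∀ u ∈ B, #(avail G S u f) ≤ t then 1 else 0 := by
    intro f
    rw [sum_boole]
    have : (A.powerset.filter fun B => ∀ u ∈ B, #(avail G S u f) ≤ t) =
        (A.filter fun u => #(avail G S u f) ≤ t).powerset := by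
      ext B
      simp only [mem_filter, mem_powerset, subset_iff]
      exact ⟨fun h u hu => ⟨h.1 hu, h.2 u hu⟩, fun h => ⟨fun u hu => (h hu).1,
        fun u hu => (h hu).2⟩⟩
    rw [this, card_powerset]
    norm_num
  simp_rw [h1]
  rw [sum_comm]
  have h2 : (1 + t / l) ^ #A * (#(properOn G k S) : ℝ) =
      ∑ B ∈ A.powerset, ((t : ℝ) / l) ^ #B * #(properOn G k S) := by
    rw [← sum_mul, add_comm, add_pow, sum_powerset_apply_card (fun n => ((t : ℝ) / l) ^ n)]
    congr 1
    refine sum_congr rfl fun i _ => ?_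
    simp [mul_comm]
  rw [h2]
  refine sum_le_sum fun B hB => ?_
  rw [mem_powerset] at hB
  rw [sum_boole, div_pow, div_mul_eq_mul_div, le_div_iff₀ (by positivity), mul_comm]
  exact pow_mul_card_short_le hk hl.le t hS (hB.trans hAS)
    fun u hu w hw => hA u (hB hu) w (hB hw)

/-- If few neighbours have few available colours, then a vertex is unlikely to have few available
colours. -/
lemma sum_half_pow_card_avail_le (hG : G.CliqueFree 3) {S : Finset V} {v : V} {t : ℕ} (ht : 1 ≤ t)
    {n d : ℝ} (hn : 0 < n) (hd : (#(S.filter (G.Adj v)) : ℝ) ≤ d) :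
    ∑ f ∈ (properOn G k S).filter (fun f => t *
        (#((S.filter (G.Adj v)).filter fun u => #(avail G S u f) ≤ t) : ℝ) ≤ k - n),
          (1 / 2 : ℝ) ^ #(avail G S v f) ≤
      Real.exp (-(n * Real.exp (-(d * (1 + (t : ℝ)⁻¹) / n)) / 2)) * #(properOn G k S) := by
  set A := S.filter (G.Adj v) with hAdef
  have hind : ∀ u ∈ A, ∀ w ∈ A, ¬ G.Adj u w := by
    intro u hu w hw huw
    rw [hAdef, mem_filter] at hu hw
    exact hG {v, u, w} (SimpleGraph.is3Clique_triple_iff.2 ⟨hu.2, hw.2, huw⟩)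
  set η := Real.exp (-(n * Real.exp (-(d * (1 + (t : ℝ)⁻¹) / n)) / 2)) with hη
  have hav : ∀ u ∈ A, ∀ f g : V → Fin k, avail G S u (A.piecewise g f) = avail G S u f := by
    intro u hu f g
    refine avail_congr (fun _ _ => Iff.rfl) fun w _ huw => ?_
    exact piecewise_eq_of_notMem _ _ _ fun hw => hind u hu w hw huw
  let few : (V → Fin k) → Prop := fun f =>
    t * (#(A.filter fun u => #(avail G S u f) ≤ t) : ℝ) ≤ k - n
  have hfew : ∀ f g : V → Fin k, few (A.piecewise g f) ↔ few f := by
    intro f g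
    simp only [few]
    rw [filter_congr fun u hu => by rw [hav u hu f g]]
  have hav' : ∀ f g : V → Fin k, avail G S v (A.piecewise g f) = missedColours A g := by
    intro f g
    ext c
    simp only [avail, ← hAdef, missedColours, mem_filter, mem_univ, true_and]
    refine forall₂_congr fun u hu => ?_
    rw [piecewise_eq_of_mem _ _ _ hu]
  -- Given the colours outside `A`, proper colourings correspond to independent choices from the
  -- lists `avail G S u f`. These lists, and hence `few`, do not depend on the colours on `A`.
  have hprop : ∀ f g : V → Fin k, A.piecewise g f ∈ properOn G k S ↔
      f ∈ properOn G k (S \ A) ∧ ∀ u ∈ A, g u ∈ avail G S u f := by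
    intro f g
    have hAS : ∀ u ∈ A, u ∈ S := fun u hu => (mem_filter.1 hu).1
    have hout : ∀ u, u ∉ A → A.piecewise g f u = f u := fun u hu => piecewise_eq_of_notMem _ _ _ hu
    have hin : ∀ u ∈ A, A.piecewise g f u = g u := fun u hu => piecewise_eq_of_mem _ _ _ hu
    constructor
    · intro h
      rw [mem_properOn] at h
      refine ⟨mem_properOn.2 fun u hu w hw huw => ?_, fun u hu => mem_avail.2 fun w hw huw => ?_⟩
      · rw [mem_sdiff] at hu hw
        simpa [hout u hu.2, hout w hw.2] using h u hu.1 w hw.1 huw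
      · have hwA : w ∉ A := fun hwA => hind u hu w hwA huw
        simpa [hin u hu, hout w hwA, eq_comm] using h u (hAS u hu) w hw huw
    · rintro ⟨h1, h2⟩
      rw [mem_properOn] at h1 ⊢
      intro u hu w hw huw
      by_cases hu' : u ∈ A <;> by_cases hw' : w ∈ A
      · exact absurd huw (hind u hu' w hw')
      · rw [hin u hu', hout w hw']
        exact (mem_avail.1 (h2 u hu') w hw huw).symm
      · rw [hin w hw', hout u hu']
        exact mem_avail.1 (h2 w hw') u hu huw.symm
      · rw [hout u hu', hout w hw']
        exact h1 u (mem_sdiff.2 ⟨hu, hu'⟩) w (mem_sdiff.2 ⟨hw, hw'⟩) huw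
  rcases isEmpty_or_nonempty (V → Fin k) with hemp | hne
  · simp [properOn, univ_eq_empty]
  have hN : (0 : ℝ) < Fintype.card (V → Fin k) := by exact_mod_cast Fintype.card_pos
  refine le_of_mul_le_mul_left ?_ hN
  classical
  have hL : ∑ f ∈ (properOn G k S).filter few, (1 / 2 : ℝ) ^ #(avail G S v f) =
      ∑ f, if f ∈ properOn G k S ∧ few f then (1 / 2 : ℝ) ^ #(avail G S v f) else 0 := by
    rw [← sum_filter]
    congr 1
    ext f
    simp
  have hR : (#((properOn G k S).filter few) : ℝ) =
      ∑ f, if f ∈ properOn G k S ∧ few f then (1 : ℝ) else 0 := by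
    rw [sum_boole]
    congr 2
    ext f
    simp
  have hcount : (Fintype.card (V → Fin k) : ℝ) *
      ∑ f ∈ (properOn G k S).filter few, (1 / 2 : ℝ) ^ #(avail G S v f) ≤
      (Fintype.card (V → Fin k) : ℝ) * (η * #((properOn G k S).filter few)) := by
    rw [mul_left_comm, hR, hL, card_mul_sum_eq_sum_piecewise _ A,
      card_mul_sum_eq_sum_piecewise _ A, mul_sum]
    refine sum_le_sum fun f _ => ?_
    simp_rw [hprop, hfew, hav']
    by_cases hf : f ∈ properOn G k (S \ A) ∧ few f
    · simp only [hf.1, hf.2, true_and, and_true]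
      exact sum_half_pow_missedColours_le A (fun u => avail G S u f) ht hn
        (by rw [Fintype.card_fin]; exact hf.2) hd
    · have : ∀ g : V → Fin k, ¬ ((f ∈ properOn G k (S \ A) ∧
          ∀ u ∈ A, g u ∈ avail G S u f) ∧ few f) := fun g hg => hf ⟨hg.1.1, hg.2⟩
      simp [this]
  refine le_trans (le_of_eq ?_) (hcount.trans ?_)
  · congr!
  · gcongr
    exact filter_subset _ _

/-- A bound on the exponential moment of the number of available colours. -/
lemma sum_half_pow_card_avail_le_of_isExpanding (hG : G.CliqueFree 3) (hk : 0 < k) {l : ℝ}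
    (hl : 0 < l) {S : Finset V} {v : V} {t : ℕ} (ht : 1 ≤ t) {n d : ℝ} (hn : 0 < n)
    (hd : (#(S.filter (G.Adj v)) : ℝ) ≤ d) (hS : IsExpanding G k l S) :
    ∑ f ∈ properOn G k S, (1 / 2 : ℝ) ^ #(avail G S v f) ≤
      (Real.exp (-(n * Real.exp (-(d * (1 + (t : ℝ)⁻¹) / n)) / 2)) +
        Real.exp (t / l * d) * 2 ^ (-((k - n) / t))) * #(properOn G k S) := by
  have htpos : (0 : ℝ) < t := by exact_mod_cast ht
  set A := S.filter (G.Adj v) with hAdef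
  have hind : ∀ u ∈ A, ∀ w ∈ A, ¬ G.Adj u w := by
    intro u hu w hw huw
    rw [hAdef, mem_filter] at hu hw
    exact hG {v, u, w} (SimpleGraph.is3Clique_triple_iff.2 ⟨hu.2, hw.2, huw⟩)
  have h1 := sum_half_pow_card_avail_le (k := k) hG ht hn hd
  have h2 := sum_two_pow_card_short_le hk hl t hS (filter_subset _ _) hind
  rw [← sum_filter_add_sum_filter_not (properOn G k S) (fun f => t *
        (#(A.filter fun u => #(avail G S u f) ≤ t) : ℝ) ≤ k - n), add_mul]
  refine add_le_add h1 ?_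
  calc _ ≤ ∑ f ∈ (properOn G k S).filter (fun f => ¬ t *
        (#(A.filter fun u => #(avail G S u f) ≤ t) : ℝ) ≤ k - n),
          (2 : ℝ) ^ #(A.filter fun u => #(avail G S u f) ≤ t) * 2 ^ (-((k - n) / t)) := by
        refine sum_le_sum fun f hf => ?_
        have hf := not_le.1 (mem_filter.1 hf).2
        -- Markov's inequality: here more than `(k - n)/t` neighbours are short, so the right-hand
        -- side is at least `1`.
        refine (pow_le_one₀ (by norm_num) (by norm_num)).trans ?_
        rw [← Real.rpow_natCast, ← Real.rpow_add two_pos]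
        refine Real.one_le_rpow one_le_two ?_
        have : (k - n) / t ≤ (#(A.filter fun u => #(avail G S u f) ≤ t) : ℝ) := by
          rw [div_le_iff₀ htpos]
          linarith
        linarith
    _ ≤ ∑ f ∈ properOn G k S,
          (2 : ℝ) ^ #(A.filter fun u => #(avail G S u f) ≤ t) * 2 ^ (-((k - n) / t)) :=
        sum_le_sum_of_subset_of_nonneg (filter_subset _ _) fun _ _ _ => by positivity
    _ ≤ (1 + t / l) ^ #A * #(properOn G k S) * 2 ^ (-((k - n) / t)) := by
        rw [← sum_mul]
        gcongr
    _ ≤ Real.exp (t / l * d) * #(properOn G k S) * 2 ^ (-((k - n) / t)) := by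
        gcongr
        calc (1 + t / l) ^ #A ≤ (Real.exp (t / l)) ^ #A := by
              gcongr
              rw [add_comm]
              exact Real.add_one_le_exp _
          _ = Real.exp (t / l * #A) := by rw [← Real.exp_nat_mul, mul_comm]
          _ ≤ _ := by gcongr
    _ = _ := by ring

/-- Every subset of a triangle-free graph of bounded degree is expanding. -/
theorem isExpanding_of_cliqueFree (hG : G.CliqueFree 3) (hk : 0 < k) {l : ℝ} (hl : 0 < l) {t : ℕ}
    (ht : 1 ≤ t) {n d η : ℝ} (hn : 0 < n) (hd : ∀ v, (#(univ.filter (G.Adj v)) : ℝ) ≤ d)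
    (hη : Real.exp (-(n * Real.exp (-(d * (1 + (t : ℝ)⁻¹) / n)) / 2)) +
        Real.exp (t / l * d) * 2 ^ (-((k - n) / t)) ≤ η)
    (hηl : η * 2 ^ (2 * l) ≤ 1 / 2) (S : Finset V) : IsExpanding G k l S := by
  induction S using Finset.strongInduction with
  | H S ih =>
    intro T v hv hTS
    have hT : IsExpanding G k l T :=
      ih T ((ssubset_insert hv).trans_subset hTS)
    have hd' : (#(T.filter (G.Adj v)) : ℝ) ≤ d :=
      le_trans (by exact_mod_cast card_le_card (filter_subset_filter _ (subset_univ T))) (hd v)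
    have h1 := sum_half_pow_card_avail_le_of_isExpanding hG hk hl ht hn hd' hT
    rw [mul_card_properOn_insert hv]
    -- The left side is at most `0` when fewer than `2 * l` colours are available. The subtracted
    -- term has mean at most `1/2`, so averaging gives at least `l`.
    have h2 : ∀ f ∈ properOn G k T,
        2 * l * (1 - (1 / 2 : ℝ) ^ #(avail G T v f) * 2 ^ (2 * l)) ≤ #(avail G T v f) := by
      intro f _
      rcases le_or_gt (2 * l) (#(avail G T v f) : ℝ) with h | h
      · have : (0 : ℝ) ≤ (1 / 2 : ℝ) ^ #(avail G T v f) * 2 ^ (2 * l) := by positivity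
        nlinarith
      · have h3 : 1 ≤ (1 / 2 : ℝ) ^ #(avail G T v f) * 2 ^ (2 * l) := by
          rw [one_div, inv_pow, ← Real.rpow_natCast, ← Real.rpow_neg zero_le_two,
            ← Real.rpow_add two_pos]
          exact Real.one_le_rpow one_le_two (by linarith)
        have h4 : (0 : ℝ) ≤ #(avail G T v f) := Nat.cast_nonneg _
        nlinarith
    refine le_trans ?_ (sum_le_sum h2)
    rw [← mul_sum, sum_sub_distrib, ← sum_mul, sum_const, nsmul_eq_mul, mul_one]
    have h3 : (∑ f ∈ properOn G k T, (1 / 2 : ℝ) ^ #(avail G T v f)) * 2 ^ (2 * l) ≤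
        1 / 2 * #(properOn G k T) := by
      calc _ ≤ η * #(properOn G k T) * 2 ^ (2 * l) := by
            gcongr
            exact h1.trans (by gcongr)
        _ = η * 2 ^ (2 * l) * #(properOn G k T) := by ring
        _ ≤ _ := by gcongr
    nlinarith

/-- Each added vertex multiplies the count by at least `l / k > 0`. -/
lemma properOn_nonempty (hk : 0 < k) {l : ℝ} (hl : 0 < l) {S : Finset V}
    (hS : IsExpanding G k l S) : (properOn G k S).Nonempty := by
  induction S using Finset.induction_on with
  | empty => exact ⟨fun _ => ⟨0, hk⟩, by simp [mem_properOn]⟩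
  | insert u T hu ih =>
    have h1 := (ih (hS.mono (subset_insert u T))).card_pos
    have h2 := hS T u hu subset_rfl
    have h3 : (0 : ℝ) < #(properOn G k T) := by exact_mod_cast h1
    have h4 : (0 : ℝ) < #(properOn G k (insert u T)) := by
      have : 0 < l * (#(properOn G k T) : ℝ) := by positivity
      exact pos_of_mul_pos_right (this.trans_le h2) (Nat.cast_nonneg k)
    exact card_pos.1 (by exact_mod_cast h4)

/-- In a random proper colouring, a vertex is unlikely to have only one available colour. -/
lemma card_avail_le_one_le (hG : G.CliqueFree 3) (hk : 0 < k) {l : ℝ} (hl : 0 < l) {t : ℕ}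
    (ht : 1 ≤ t) {n d η : ℝ} (hn : 0 < n) (hd : ∀ v, (#(univ.filter (G.Adj v)) : ℝ) ≤ d)
    (hη : Real.exp (-(n * Real.exp (-(d * (1 + (t : ℝ)⁻¹) / n)) / 2)) +
        Real.exp (t / l * d) * 2 ^ (-((k - n) / t)) ≤ η)
    (hηl : η * 2 ^ (2 * l) ≤ 1 / 2) (u : V) :
    (#((properOn G k univ).filter fun f => #(avail G univ u f) ≤ 1) : ℝ) ≤
      2 * η / l * #(properOn G k univ) := by
  have hexp := isExpanding_of_cliqueFree hG hk hl ht hn hd hη hηl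
  have hη0 : 0 ≤ η := le_trans (by positivity) hη
  obtain ⟨T, huT, hT⟩ : ∃ T : Finset V, u ∉ T ∧ insert u T = univ :=
    ⟨univ.erase u, notMem_erase u _, insert_erase (mem_univ u)⟩
  have hd' : (#(T.filter (G.Adj u)) : ℝ) ≤ d :=
    le_trans (by exact_mod_cast card_le_card (filter_subset_filter _ (subset_univ T))) (hd u)
  have h1 := (sum_half_pow_card_avail_le_of_isExpanding hG hk hl ht hn hd' (hexp T)).trans
    (mul_le_mul_of_nonneg_right hη (Nat.cast_nonneg _))
  have hup : ∀ f x, avail G univ u (Function.update f u x) = avail (k := k) G T u f := by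
    intro f x
    refine avail_congr (fun y hy => ?_) fun y _ hy => Function.update_of_ne hy.ne' _ _
    simp [← hT, hy.ne']
  have hav : ∀ f, avail (k := k) G univ u f = avail G T u f := fun f => by
    simpa using hup f (f u)
  have h2 := mul_sum_properOn_insert (G := G) (k := k) huT
    (fun f => if #(avail G univ u f) ≤ 1 then 1 else 0) (fun f x => by rw [hup, hav])
  rw [hT, sum_boole] at h2
  -- For `m ≤ 1` one has `m ≤ 2 * (1/2)^m`, with equality at `m = 1`. The weight `#(avail G T u f)`
  -- comes from exposing `u` last.
  have h3 : ∑ f ∈ properOn G k T, (#(avail G T u f) : ℝ) *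
      (if #(avail G univ u f) ≤ 1 then 1 else 0) ≤
      2 * ∑ f ∈ properOn G k T, (1 / 2 : ℝ) ^ #(avail G T u f) := by
    rw [mul_sum]
    refine sum_le_sum fun f _ => ?_
    rw [hav]
    split_ifs with h
    · interval_cases #(avail G T u f) <;> norm_num
    · rw [mul_zero]; positivity
  have h4 : l * #(properOn G k T) ≤ k * #(properOn G k univ) := by
    have := hexp univ T u huT (subset_univ _)
    rwa [hT] at this
  have hk' : (0 : ℝ) < k := by exact_mod_cast hk
  refine le_of_mul_le_mul_left ?_ hk'
  calc _ ≤ 2 * (η * #(properOn G k T)) := by rw [h2]; linarith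
    _ = 2 * η / l * (l * #(properOn G k T)) := by field_simp
    _ ≤ 2 * η / l * (k * #(properOn G k univ)) := by gcongr
    _ = _ := by ring

end Counting

/-! ### Recolouring a vertex through its neighbours -/

section Recolouring

variable {V : Type*} [Fintype V] [DecidableEq V] {G : SimpleGraph V} [DecidableRel G.Adj] {k : ℕ}

/-- Changing the colours of a set of neighbours of `v` to available ones, one at a time. -/
lemma exists_walk_recolour_neighbours (hG : G.CliqueFree 3) (τ : G.Coloring (Fin k)) {v : V}
    (alt : V → Fin k) (B : Finset V) (hB : ∀ u ∈ B, G.Adj v u)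
    (halt : ∀ u ∈ B, alt u ∈ avail G univ u τ ∧ alt u ≠ τ u) :
    ∃ (σ : G.Coloring (Fin k)) (w : (colouringGraph G k 1).Walk τ σ),
      (∀ x, σ x = if x ∈ B then alt x else τ x) ∧
      ∀ ρ ∈ w.support, ∀ u : V, u ≠ v → ¬ G.Adj v u → ρ u = τ u := by
  induction B using Finset.induction_on with
  | empty => exact ⟨τ, .nil, by simp, by simp⟩
  | insert u B hu ih =>
    obtain ⟨σ, w, hσ, hw⟩ := ih (fun x hx => hB x (mem_insert_of_mem hx))
      fun x hx => halt x (mem_insert_of_mem hx)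
    -- Neighbours of `v` are pairwise non-adjacent, so colours available in `τ` can be adopted by
    -- several of them together.
    have hind : ∀ x ∈ insert u B, ∀ y ∈ insert u B, ¬ G.Adj x y := fun x hx y hy hxy =>
      hG {v, x, y} (SimpleGraph.is3Clique_triple_iff.2 ⟨hB x hx, hB y hy, hxy⟩)
    let σ' : G.Coloring (Fin k) := SimpleGraph.Coloring.mk
      (fun x => if x ∈ insert u B then alt x else τ x) (by
        intro x y hxy
        by_cases hx : x ∈ insert u B <;> by_cases hy : y ∈ insert u B
        · exact absurd hxy (hind x hx y hy)
        · rw [if_pos hx, if_neg hy]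
          exact (mem_avail.1 (halt x hx).1 y (mem_univ y) hxy).symm
        · rw [if_neg hx, if_pos hy]
          exact mem_avail.1 (halt y hy).1 x (mem_univ x) hxy.symm
        · rw [if_neg hx, if_neg hy]
          exact τ.valid hxy)
    have hσ' : ∀ x, σ' x = if x ∈ insert u B then alt x else τ x := fun x => rfl
    have hdiff : ∀ x, x ≠ u → σ x = σ' x := fun x hx => by
      rw [hσ, hσ']
      simp [hx]
    have hadj : (colouringGraph G k 1).Adj σ σ' := by
      refine ⟨fun h => ?_, ?_⟩
      · have h1 : σ u = σ' u := by rw [h]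
        rw [hσ, hσ', if_neg hu, if_pos (mem_insert_self u B)] at h1
        exact (halt u (mem_insert_self u B)).2 h1.symm
      · rw [hammingDist]
        refine card_le_one.2 fun x hx y hy => ?_
        rw [mem_filter] at hx hy
        rw [not_imp_comm.1 (hdiff x) hx.2, not_imp_comm.1 (hdiff y) hy.2]
    refine ⟨σ', w.concat hadj, hσ', fun ρ hρ x hxv hvx => ?_⟩
    simp only [SimpleGraph.Walk.support_concat, List.mem_append, List.mem_singleton] at hρ
    rcases hρ with hρ | rfl
    · exact hw ρ hρ x hxv hvx
    · rw [hσ', if_neg fun hx => hvx (hB x hx)]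

/-- If every neighbour of `v` has at least two available colours, then `v` can be given any other
colour by recolouring only `v` and its neighbours. -/
lemma exists_walk_of_one_lt_card_avail (hG : G.CliqueFree 3) (τ : G.Coloring (Fin k)) {v : V}
    (hv : ∀ u, G.Adj v u → 1 < #(avail G univ u τ)) {j : Fin k} (hj : j ≠ τ v) :
    ∃ (σ : G.Coloring (Fin k)) (w : (colouringGraph G k 1).Walk τ σ), σ v = j ∧
      ∀ ρ ∈ w.support, ∀ u : V, u ≠ v → ¬ G.Adj v u → ρ u = τ u := by
  have hex : ∀ u, G.Adj v u → ∃ c, c ∈ avail G univ u τ ∧ c ≠ τ u := fun u hu =>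
    exists_mem_ne (hv u hu) (τ u)
  have : Nonempty (Fin k) := ⟨j⟩
  choose! alt halt using hex
  -- Only the neighbours coloured `j` need to move.
  obtain ⟨σ, w, hσ, hw⟩ := exists_walk_recolour_neighbours hG τ alt
    (univ.filter fun u => G.Adj v u ∧ τ u = j) (fun u hu => (mem_filter.1 hu).2.1)
    fun u hu => halt u (mem_filter.1 hu).2.1
  have hσj : ∀ u, G.Adj v u → σ u ≠ j := by
    intro u hu
    rw [hσ]
    split_ifs with h
    · simp only [mem_filter, mem_univ, true_and] at h
      rw [← h.2]
      exact (halt u hu).2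
    · simpa [hu] using h
  let σ' : G.Coloring (Fin k) := SimpleGraph.Coloring.mk (Function.update σ v j) (by
    intro x y hxy
    by_cases hx : x = v
    · subst hx
      rw [Function.update_self, Function.update_of_ne hxy.ne']
      exact (hσj y hxy).symm
    · by_cases hy : y = v
      · subst hy
        rw [Function.update_self, Function.update_of_ne hx]
        exact hσj x hxy.symm
      · rw [Function.update_of_ne hx, Function.update_of_ne hy]
        exact σ.valid hxy)
  have hσ'v : σ' v = j := Function.update_self ..
  have hσ' : ∀ x, x ≠ v → σ' x = σ x := fun x hx => Function.update_of_ne hx ..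
  have hσv : σ v = τ v := by rw [hσ]; simp
  have hadj : (colouringGraph G k 1).Adj σ σ' := by
    refine ⟨fun h => hj ?_, ?_⟩
    · rw [← hσ'v, ← h, hσv]
    · rw [hammingDist]
      refine card_le_one.2 fun x hx y hy => ?_
      rw [mem_filter] at hx hy
      rw [not_imp_comm.1 (hσ' x) (Ne.symm hx.2), not_imp_comm.1 (hσ' y) (Ne.symm hy.2)]
  refine ⟨σ', w.concat hadj, hσ'v, fun ρ hρ x hxv hvx => ?_⟩
  simp only [SimpleGraph.Walk.support_concat, List.mem_append, List.mem_singleton] at hρ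
  rcases hρ with hρ | rfl
  · exact hw ρ hρ x hxv hvx
  · rw [hσ' x hxv]
    exact hw σ w.end_mem_support x hxv hvx

/-- If every neighbour of `v` has at least two available colours, then `v` is loose, thawed and
locally recolourable. -/
theorem isLoose_and_isThawed_and_isLocallyRecolourable (hG : G.CliqueFree 3)
    (τ : G.Coloring (Fin k)) {v : V} {Δ : ℕ} (hΔ : #(univ.filter (G.Adj v)) ≤ Δ)
    (hv : ∀ u, G.Adj v u → 1 < #(avail G univ u τ)) :
    IsLoose G k (Δ + 1) τ v ∧ IsThawed G k 1 τ v ∧ IsLocallyRecolourable G k τ v := by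
  have hloc : IsLocallyRecolourable G k τ v := by
    intro j
    by_cases hj : j = τ v
    · exact ⟨τ, .nil, hj.symm, by simp⟩
    · exact exists_walk_of_one_lt_card_avail hG τ hv hj
  refine ⟨fun j hj => ?_, fun j => ?_, hloc⟩
  · obtain ⟨σ, w, hσ, hw⟩ := hloc j
    refine ⟨σ, ⟨fun h => hj (by rw [← hσ, h]), ?_⟩, hσ⟩
    -- The end of the walk differs from `τ` only in the closed neighbourhood of `v`, hence the `Δ +
    -- 1`.
    have hsub : (univ.filter fun x => τ x ≠ σ x) ⊆ insert v (univ.filter (G.Adj v)) := by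
      intro x hx
      rw [mem_filter] at hx
      by_contra h
      simp only [mem_insert, mem_filter, mem_univ, true_and, not_or] at h
      exact hx.2 (hw σ w.end_mem_support x h.1 h.2).symm
    rw [hammingDist]
    exact (card_le_card hsub).trans ((card_insert_le _ _).trans (Nat.add_le_add_right hΔ 1))
  · obtain ⟨σ, w, hσ, _⟩ := hloc j
    exact ⟨σ, (SimpleGraph.ConnectedComponent.eq.2 w.reachable).symm, hσ⟩

end Recolouring

/-! ### From counts to probabilities -/

section Probability

variable {V : Type*} [Fintype V] [DecidableEq V] {G : SimpleGraph V} [DecidableRel G.Adj] {k : ℕ}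

lemma coloring_mem_properOn_univ (τ : G.Coloring (Fin k)) : (fun v => τ v) ∈ properOn G k univ :=
  mem_properOn.2 fun _ _ _ _ h => τ.valid h

/-- An event that holds for all but few proper colourings is likely. -/
lemma one_sub_le_colouringProb [Nonempty (G.Coloring (Fin k))] {E : Set (G.Coloring (Fin k))}
    {q : ℝ} (B : Finset (V → Fin k)) (hB : ∀ τ : G.Coloring (Fin k), (fun v => τ v) ∉ B → τ ∈ E)
    (hq : (#B : ℝ) ≤ q * #(properOn G k univ)) :
    1 - q ≤ colouringProb G k E := by
  classical
  have : Finite (G.Coloring (Fin k)) := DFunLike.finite _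
  let _ : Fintype (G.Coloring (Fin k)) := Fintype.ofFinite _
  have hval : colouringProb G k E =
      (#(univ.filter (· ∈ E)) : ℝ) / Fintype.card (G.Coloring (Fin k)) := by
    rw [colouringProb, uniformColouring, PMF.toOuterMeasure_uniformOfFintype_apply,
      ENNReal.toReal_div, ENNReal.toReal_natCast, ENNReal.toReal_natCast, Fintype.card_subtype]
  have hinj : Function.Injective (fun (τ : G.Coloring (Fin k)) (v : V) => τ v) :=
    DFunLike.coe_injective
  have hcard : Fintype.card (G.Coloring (Fin k)) = #(properOn G k univ) := by
    rw [← card_univ, ← card_image_of_injective univ hinj]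
    congr 1
    ext f
    simp only [mem_image, mem_univ, true_and]
    constructor
    · rintro ⟨τ, rfl⟩
      exact coloring_mem_properOn_univ τ
    · intro hf
      exact ⟨SimpleGraph.Coloring.mk f fun {u w} h =>
        mem_properOn.1 hf u (mem_univ u) w (mem_univ w) h, rfl⟩
  have hbad : #(univ.filter (· ∉ E)) ≤ #B := by
    rw [← card_image_of_injective _ hinj]
    refine card_le_card fun f hf => ?_
    obtain ⟨τ, hτ, rfl⟩ := mem_image.1 hf
    exact not_imp_comm.1 (hB τ) (mem_filter.1 hτ).2
  have hadd := card_filter_add_card_filter_not (s := (univ : Finset (G.Coloring (Fin k)))) (· ∈ E)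
  rw [card_univ] at hadd
  have hpos : (0 : ℝ) < Fintype.card (G.Coloring (Fin k)) := by exact_mod_cast Fintype.card_pos
  rw [hval, le_div_iff₀ hpos]
  rw [← hcard] at hq
  have h1 : (#(univ.filter (· ∈ E)) : ℝ) + #(univ.filter (· ∉ E)) =
      Fintype.card (G.Coloring (Fin k)) := by exact_mod_cast hadd
  have h2 : (#(univ.filter (· ∉ E)) : ℝ) ≤ #B := by
    exact_mod_cast hbad
  linarith

/-- Existence of colourings and likely local recolourability, given numerical conditions. -/
theorem exists_coloring_and_le_colouringProb (hG : G.CliqueFree 3) (hk : 0 < k) {l : ℝ}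
    (hl : 0 < l) {t Δ : ℕ} (ht : 1 ≤ t) {n η p : ℝ} (hn : 0 < n)
    (hΔ : ∀ v, #(univ.filter (G.Adj v)) ≤ Δ)
    (hη : Real.exp (-(n * Real.exp (-(Δ * (1 + (t : ℝ)⁻¹) / n)) / 2)) +
        Real.exp (t / l * Δ) * 2 ^ (-((k - n) / t)) ≤ η)
    (hηl : η * 2 ^ (2 * l) ≤ 1 / 2) (hp : Δ * (2 * η / l) ≤ p) :
    ∃ _ : Nonempty (G.Coloring (Fin k)), ∀ v : V, 1 - p ≤ colouringProb G k
      {τ | IsLoose G k (Δ + 1) τ v ∧ IsThawed G k 1 τ v ∧ IsLocallyRecolourable G k τ v} := by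
  have hd : ∀ v, (#(univ.filter (G.Adj v)) : ℝ) ≤ Δ := fun v => by exact_mod_cast hΔ v
  have hη0 : 0 ≤ η := le_trans (by positivity) hη
  obtain ⟨f, hf⟩ := properOn_nonempty hk hl
    (isExpanding_of_cliqueFree hG hk hl ht hn hd hη hηl univ)
  have hne : Nonempty (G.Coloring (Fin k)) := ⟨SimpleGraph.Coloring.mk f fun {u w} h =>
    mem_properOn.1 hf u (mem_univ u) w (mem_univ w) h⟩
  refine ⟨hne, fun v => ?_⟩
  -- Union bound over the neighbours of `v` with at most one available colour.
  refine one_sub_le_colouringProb ((univ.filter (G.Adj v)).biUnion fun u =>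
    (properOn G k univ).filter fun f => #(avail G univ u f) ≤ 1) (fun τ hτ => ?_) ?_
  · refine isLoose_and_isThawed_and_isLocallyRecolourable hG τ (hΔ v) fun u hu => ?_
    by_contra h
    exact hτ (mem_biUnion.2 ⟨u, by simpa using hu,
      mem_filter.2 ⟨coloring_mem_properOn_univ τ, not_lt.1 h⟩⟩)
  · calc _ ≤ ∑ u ∈ univ.filter (G.Adj v),
          (#((properOn G k univ).filter fun f => #(avail G univ u f) ≤ 1) : ℝ) := by
          exact_mod_cast card_biUnion_le
      _ ≤ ∑ u ∈ univ.filter (G.Adj v), 2 * η / l * #(properOn G k univ) :=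
          sum_le_sum fun u _ => card_avail_le_one_le hG hk hl ht hn hd hη hηl u
      _ = #(univ.filter (G.Adj v)) * (2 * η / l) * #(properOn G k univ) := by
          rw [sum_const, nsmul_eq_mul, mul_assoc]
      _ ≤ p * #(properOn G k univ) := by
          refine mul_le_mul_of_nonneg_right (le_trans ?_ hp) (Nat.cast_nonneg _)
          exact mul_le_mul_of_nonneg_right (hd v) (by positivity)

end Probability

/-! ### Choice of parameters and asymptotic estimates -/

section Estimates

open Filter

lemma eventually_rpow_le_mul_rpow {a b c : ℝ} (hab : a < b) (hc : 0 < c) :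
    ∀ᶠ x : ℝ in atTop, x ^ a ≤ c * x ^ b := by
  filter_upwards [(tendsto_rpow_atTop (sub_pos.2 hab)).eventually_ge_atTop c⁻¹,
    eventually_gt_atTop 0] with x hx hx0
  rw [Real.rpow_sub hx0, le_div_iff₀ (by positivity)] at hx
  rwa [← inv_mul_le_iff₀ hc]

/-- All comparisons that require `k` to be large. The exponent `5 * ε / 12` is `5/4` times `ε/3`: it
bounds `Δ^(ε/3)` through `Δ ≤ k log k ≤ k^(5/4)`. -/
lemma eventually_log_rpow_le {ε : ℝ} (hε : 0 < ε) (a : ℝ) {b : ℝ} (hb : 0 < b) :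
    ∀ᶠ k : ℕ in atTop, a ≤ Real.log k ∧ Real.log k ≤ (k : ℝ) ^ (1 / 4 : ℝ) ∧
      a ≤ (k : ℝ) ^ (ε / 2) ∧ Real.log k ^ 2 ≤ 1 / 16 * (k : ℝ) ^ (ε / 2) ∧
      (k : ℝ) ^ (5 * ε / 12) ≤ 1 / 32 * (k : ℝ) ^ (ε / 2) ∧ (k : ℝ) ^ (1 / 2 : ℝ) ≤ b * k := by
  have h1 := Real.tendsto_log_atTop.eventually_ge_atTop a
  have h2 := (isLittleO_log_rpow_atTop (r := 1 / 4) (by norm_num)).bound one_pos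
  have h3 := (tendsto_rpow_atTop (y := ε / 2) (by positivity)).eventually_ge_atTop a
  have h4 := (isLittleO_log_rpow_rpow_atTop (2 : ℝ) (s := ε / 2) (by positivity)).bound
    (by norm_num : (0 : ℝ) < 1 / 16)
  have h5 := eventually_rpow_le_mul_rpow (show 5 * ε / 12 < ε / 2 by linarith)
    (by norm_num : (0 : ℝ) < 1 / 32)
  have h6 := eventually_rpow_le_mul_rpow (show (1 / 2 : ℝ) < 1 by norm_num) hb
  refine tendsto_natCast_atTop_atTop.eventually
    (p := fun x : ℝ => a ≤ Real.log x ∧ Real.log x ≤ x ^ (1 / 4 : ℝ) ∧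
      a ≤ x ^ (ε / 2) ∧ Real.log x ^ 2 ≤ 1 / 16 * x ^ (ε / 2) ∧
      x ^ (5 * ε / 12) ≤ 1 / 32 * x ^ (ε / 2) ∧ x ^ (1 / 2 : ℝ) ≤ b * x) ?_
  filter_upwards [h1, h2, h3, h4, h5, h6, eventually_ge_atTop 1] with x h1 h2 h3 h4 h5 h6 hx
  have hx0 : 0 ≤ x := by linarith
  have hn : ∀ s : ℝ, ‖x ^ s‖ = x ^ s := fun s =>
    Real.norm_of_nonneg (Real.rpow_nonneg hx0 s)
  rw [hn, one_mul] at h2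
  rw [hn, Real.rpow_two, Real.norm_of_nonneg (sq_nonneg _)] at h4
  rw [Real.rpow_one] at h6
  exact ⟨h1, (le_abs_self _).trans h2, h3, h4, h5, h6⟩

/-- The numerical conditions for recolourability hold for many colours. -/
lemma eventually_numerical_conditions {ε : ℝ} (hε : 0 < ε) (hε1 : ε ≤ 1) :
    ∃ t : ℕ, 1 ≤ t ∧ ∀ᶠ k : ℕ in atTop, ∀ Δ : ℕ, (Δ : ℝ) ≤ (1 - ε) * k * Real.log k →
      ∃ l n η : ℝ, 0 < k ∧ 0 < l ∧ 0 < n ∧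
        Real.exp (-(n * Real.exp (-(Δ * (1 + (t : ℝ)⁻¹) / n)) / 2)) +
          Real.exp (t / l * Δ) * 2 ^ (-((k - n) / t)) ≤ η ∧
        η * 2 ^ (2 * l) ≤ 1 / 2 ∧ Δ * (2 * η / l) ≤ Real.exp (-((Δ : ℝ) ^ (ε / 3))) := by
  -- With `1/t ≤ ε/4` and `n = (1 - ε/6)k`, the losses fit into the slack: `(1 - ε)(1 + ε/4) ≤ (1 -
  -- ε/2)(1 - ε/6)`.
  set t : ℕ := ⌈4 / ε⌉₊ with ht
  have ht4 : 4 / ε ≤ t := Nat.le_ceil _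
  have htpos : (0 : ℝ) < t := lt_of_lt_of_le (by positivity) ht4
  have htinv : (t : ℝ)⁻¹ ≤ ε / 4 := by
    rw [inv_le_comm₀ htpos (by positivity), inv_div]
    exact ht4
  have ht1 : 1 ≤ t := by exact_mod_cast htpos
  refine ⟨t, ht1, ?_⟩
  filter_upwards [eventually_log_rpow_le hε (max 64 (24 * t ^ 2 / ε))
    (b := ε / (6 * t)) (by positivity), eventually_gt_atTop 0] with k hk hk0 Δ hΔ
  obtain ⟨hlog, hlog4, hY, hlogsq, hpow, hhalf⟩ := hk
  have hkR : (0 : ℝ) < k := by exact_mod_cast hk0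
  have hk1 : (1 : ℝ) ≤ k := by exact_mod_cast hk0
  set lg := Real.log k with hlg
  set Y := (k : ℝ) ^ (ε / 2) with hYdef
  have hlog64 : 64 ≤ lg := (le_max_left _ _).trans hlog
  have hlogt : 24 * t ^ 2 / ε ≤ lg := (le_max_right _ _).trans hlog
  have hY64 : 64 ≤ Y := (le_max_left _ _).trans hY
  have hlg0 : 0 < lg := by linarith
  have hΔ' : (Δ : ℝ) ≤ k * lg := by nlinarith [mul_pos hkR hlg0]
  have hlog2 : Real.log 2 ≤ 1 := by linarith [Real.log_two_lt_d9]
  have hlog2' : 1 / 2 ≤ Real.log 2 := by linarith [Real.log_two_gt_d9]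
  set n : ℝ := (1 - ε / 6) * k with hn
  have hn0 : 0 < n := by
    have : 0 < 1 - ε / 6 := by linarith
    positivity
  have hmissed : Y / 4 ≤ n * Real.exp (-(Δ * (1 + (t : ℝ)⁻¹) / n)) / 2 := by
    have h1 : Δ * (1 + (t : ℝ)⁻¹) / n ≤ (1 - ε / 2) * lg := by
      rw [div_le_iff₀ hn0]
      calc Δ * (1 + (t : ℝ)⁻¹) ≤ ((1 - ε) * k * lg) * (1 + ε / 4) := by gcongr
        _ = ((1 - ε) * (1 + ε / 4)) * (k * lg) := by ring
        _ ≤ ((1 - ε / 2) * (1 - ε / 6)) * (k * lg) := by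
            refine mul_le_mul_of_nonneg_right ?_ (by positivity)
            nlinarith
        _ = _ := by rw [hn]; ring
    have h2 : Real.exp (-((1 - ε / 2) * lg)) * k = Y := by
      have h3 : (k : ℝ) = Real.exp lg := (Real.exp_log hkR).symm
      rw [hYdef, Real.rpow_def_of_pos hkR, ← hlg, h3, ← Real.exp_add]
      congr 1
      ring
    calc Y / 4 = (1 / 2 * k) * Real.exp (-((1 - ε / 2) * lg)) / 2 := by rw [← h2]; ring
      _ ≤ n * Real.exp (-(Δ * (1 + (t : ℝ)⁻¹) / n)) / 2 := by
          have h3 : 1 / 2 * (k : ℝ) ≤ n := by rw [hn]; nlinarith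
          gcongr
  -- The first term is at most a quarter of `(k - n)/t = εk/(6t)`, while `log 2 ≥ 1/2` makes the
  -- second at most minus one half of it. The remaining quarter dominates `Y/4`, as `Y ≤ k^(1/2)`.
  have hshort : t / lg ^ 2 * Δ + -((k - n) / t) * Real.log 2 ≤ -(Y / 4) := by
    have h1 : t / lg ^ 2 * Δ ≤ ε / (24 * t) * k := by
      calc t / lg ^ 2 * Δ ≤ t / lg ^ 2 * (k * lg) := by gcongr
        _ = t / lg * k := by field_simp
        _ ≤ ε / (24 * t) * k := by
            refine mul_le_mul_of_nonneg_right ?_ hkR.le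
            rw [div_le_iff₀ hε] at hlogt
            rw [div_le_div_iff₀ hlg0 (by positivity)]
            nlinarith
    have h2 : (k - n) / t = ε / (6 * t) * k := by
      rw [hn]
      field_simp
      ring
    have h3 : Y ≤ ε / (6 * t) * k :=
      (Real.rpow_le_rpow_of_exponent_le hk1 (by linarith)).trans hhalf
    have h4 : ε / (24 * t) * k = ε / (6 * t) * k / 4 := by
      field_simp
      norm_num
    rw [h4] at h1
    have h5 : 0 ≤ ε / (6 * t) * k := by positivity
    have h6 := mul_le_mul_of_nonneg_left hlog2' h5
    rw [h2]
    linarith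
  -- The choice `l = (log k)^2` is large enough that `tΔ/l = O(k / log k)`, yet small enough that
  -- `exp (-Y/4)` beats `2^(2l)`. Each of the two error terms is at most `exp (-Y/4)`.
  refine ⟨lg ^ 2, n, 2 * Real.exp (-(Y / 4)), hk0, by positivity, hn0, ?_, ?_, ?_⟩
  · rw [two_mul]
    refine add_le_add (by gcongr) ?_
    rw [Real.rpow_def_of_pos two_pos, ← Real.exp_add, Real.exp_le_exp]
    linarith
  · rw [Real.rpow_def_of_pos two_pos, mul_assoc, ← Real.exp_add]
    have h1 : Real.exp (-(Y / 4) + Real.log 2 * (2 * lg ^ 2)) ≤ Real.exp (-2) := by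
      rw [Real.exp_le_exp]
      have := mul_le_mul_of_nonneg_right hlog2 (by positivity : 0 ≤ 2 * lg ^ 2)
      linarith
    have h2 : Real.exp (-2) ≤ 1 / 4 := by
      have : Real.log 4 = 2 * Real.log 2 := by
        rw [show (4 : ℝ) = 2 ^ 2 by norm_num, Real.log_pow]
        norm_num
      rw [← Real.le_log_iff_exp_le (by norm_num), one_div, Real.log_inv, this]
      linarith
    linarith
  · have h1 : (Δ : ℝ) ^ (ε / 3) ≤ Y / 32 := by
      calc (Δ : ℝ) ^ (ε / 3) ≤ ((k : ℝ) ^ (5 / 4 : ℝ)) ^ (ε / 3) := by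
            gcongr
            calc (Δ : ℝ) ≤ k * (k : ℝ) ^ (1 / 4 : ℝ) := hΔ'.trans (by gcongr)
              _ = (k : ℝ) ^ (5 / 4 : ℝ) := by
                  rw [← Real.rpow_one_add' hkR.le (by norm_num)]
                  norm_num
        _ = (k : ℝ) ^ (5 * ε / 12) := by
            rw [← Real.rpow_mul hkR.le]
            congr 1
            ring
        _ ≤ _ := by linarith
    have h2 : (4 : ℝ) ≤ Real.exp 2 := by
      have := Real.add_one_le_exp (1 : ℝ)
      rw [show (2 : ℝ) = 1 + 1 by norm_num, Real.exp_add]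
      nlinarith
    calc Δ * (2 * (2 * Real.exp (-(Y / 4))) / lg ^ 2)
        ≤ k * lg * (2 * (2 * Real.exp (-(Y / 4))) / lg ^ 2) := by gcongr
      _ = 4 * k * Real.exp (-(Y / 4)) / lg := by field_simp; norm_num
      _ ≤ 4 * k * Real.exp (-(Y / 4)) := div_le_self (by positivity) (by linarith)
      _ ≤ Real.exp 2 * Real.exp lg * Real.exp (-(Y / 4)) := by
          rw [hlg, Real.exp_log hkR]
          gcongr
      _ ≤ Real.exp (-((Δ : ℝ) ^ (ε / 3))) := by
          rw [← Real.exp_add, ← Real.exp_add, Real.exp_le_exp]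
          -- From `2 ≤ Y/32` and `lg^2 ≤ Y/16`, the exponent is at most `-5Y/32`, well below
          -- `-Y/32`.
          have : lg ≤ lg ^ 2 := le_self_pow₀ (by linarith) two_ne_zero
          linarith

end Estimates

end ColouringGeometry

/-- The uniform distribution only makes sense if `G` has a proper `k`-colouring; that there is one
is part of the claim. -/
theorem mainTheorem3 (ε : ℝ) (hε : 0 < ε) :
    ∀ᶠ k : ℕ in Filter.atTop, ∀ Δ : ℕ, (Δ : ℝ) ≤ (1 - ε) * k * Real.log k →
      ∀ (V : Type*) [Fintype V] (G : SimpleGraph V) [DecidableRel G.Adj],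
        G.CliqueFree 3 → G.maxDegree ≤ Δ →
        ∃ _ : Nonempty (G.Coloring (Fin k)), ∀ v : V,
          1 - Real.exp (-((Δ : ℝ) ^ (ε / 3))) ≤
            ColouringGeometry.colouringProb G k
              {τ | ColouringGeometry.IsLoose G k (Δ + 1) τ v ∧
                ColouringGeometry.IsThawed G k 1 τ v ∧
                ColouringGeometry.IsLocallyRecolourable G k τ v} := by
  rcases lt_or_ge 1 ε with hε1 | hε1
  -- For `ε > 1` the upper bound on `Δ` is negative, so no `Δ` qualifies.
  · filter_upwards [Filter.eventually_gt_atTop 1] with k hk Δ hΔ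
    have h1 : (0 : ℝ) < k := by exact_mod_cast (by omega : 0 < k)
    have h2 : 0 < Real.log k := Real.log_pos (by exact_mod_cast hk)
    have h3 : (0 : ℝ) ≤ Δ := Nat.cast_nonneg Δ
    nlinarith [mul_pos (mul_pos (sub_pos.2 hε1) h1) h2]
  · obtain ⟨t, ht, h⟩ := ColouringGeometry.eventually_numerical_conditions hε hε1
    filter_upwards [h] with k hk Δ hΔ V _ G _ hG hdeg
    classical
    obtain ⟨l, n, η, hk0, hl, hn, hη, hηl, hp⟩ := hk Δ hΔ
    refine ColouringGeometry.exists_coloring_and_le_colouringProb hG hk0 hl ht hn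
      (fun v => ?_) hη hηl hp
    rw [← SimpleGraph.neighborFinset_eq_filter, SimpleGraph.card_neighborFinset_eq_degree]
    exact (G.degree_le_maxDegree v).trans hdeg
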